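/- A real number $x$ is \emph{computable} if there is a computable sequence of integers $(z_n)_{n\in\mathbb N}$ with $|x-z_n2^{-n}|\le 2^{-n}$ for all $n$; a point of $\mathbb R^2$ is computable if both of its coordinates are. A function $h:[0,1]\to\mathbb R$ is \emph{computable} (in the sense of Grzegorczyk and Lacombe) if its values at the rational points of $[0,1]$ are computable uniformly in the rational argument and $h$ has a computable modulus of uniform continuity; a path $[0,1]\to\mathbb R^2$ is computable if both of its coordinate functions are. Let $f,g:[0,1]\to[0,1]^2$ be computable paths such that $f(0)=(0,0)$, $f(1)=(1,1)$, $g(0)=(0,1)$, $g(1)=(1,0)$, and such that $f(t),g(t)\in(0,1)^2$ for all $0<t<1$. For rational numbers $a\in[0,1]$ and $r>0$ such that the closed Euclidean ball $\overline{B(f(a),r)}$ is contained in $(0,1)^2$, let $(p_{ar},q_{ar})$ be the longest open interval $I\subseteq[0,1]$ with $a\in I$ and $f(I)\subseteq B(f(a),r)$. Let $Q$ be the following statement: there are rational numbers $a\in[0,1]$ and $0<r<s$ with $\overline{B(f(a),s)}\subseteq(0,1)^2$ such that for every rational $t\in[r,s]$, $f(p_{at})\in\operatorname{range}(g)$ or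 $f(q_{at})\in\operatorname{range}(g)$. \textbf{Theorem.} If $Q$ is false, then there is a computable point $x\in\operatorname{range}(f)\cap\operatorname{range}(g)$. -/

import Mathlib

open Set

/-- The Euclidean plane. -/
abbrev Plane : Type := EuclideanSpace ℝ (Fin 2)

/-- The open unit square `(0;1)²`. -/
def openUnitSquare : Set Plane := {x | ∀ i, x i ∈ Ioo (0 : ℝ) 1}

/-- A real number is computable if some computable sequence of integers `z` satisfies
`|x - z n / 2 ^ n| ≤ 1 / 2 ^ n` for all `n`. -/
def IsComputableReal (x : ℝ) : Prop :=
  ∃ z : ℕ → ℤ, Computable z ∧ ∀ n, |x - z n / 2 ^ n| ≤ 1 / 2 ^ n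

/-- A point of the plane is computable if its coordinates are. -/
def IsComputablePoint (x : Plane) : Prop := ∀ i, IsComputableReal (x i)

/-- Computability (in the sense of Grzegorczyk and Lacombe) of a real function on the compact
interval `[0;1]`: the values at the rational points `k / l` of `[0;1]` are computable real numbers,
uniformly in `k` and `l`, and there is a computable modulus of uniform continuity.
The values of `h` outside of `[0;1]` are irrelevant. -/
def IsComputableOnUnitInterval (h : ℝ → ℝ) : Prop :=
  (∃ z : ℕ × ℕ × ℕ → ℤ, Computable z ∧ ∀ k l n : ℕ, 0 < l → k ≤ l →
      |h ((k : ℝ) / (l : ℝ)) - z (k, l, n) / 2 ^ n| ≤ 1 / 2 ^ n) ∧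
  (∃ m : ℕ → ℕ, Computable m ∧ ∀ n : ℕ, ∀ s ∈ Icc (0 : ℝ) 1, ∀ t ∈ Icc (0 : ℝ) 1,
      |s - t| ≤ 1 / 2 ^ m n → |h s - h t| ≤ 1 / 2 ^ n)

/-- A path `[0;1] → ℝ²` (given by a function on `ℝ` of which only the restriction to `[0;1]`
matters) is computable if both of its coordinate functions are. -/
def IsComputablePath (f : ℝ → Plane) : Prop :=
  ∀ i, IsComputableOnUnitInterval (fun t => f t i)

/-- The curve of a path, that is, its range as a function on `[0;1]`. -/
def curve (f : ℝ → Plane) : Set Plane := f '' Icc 0 1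

/-- `min L`, the right end point of the longest interval `I` in `[0;1]` around `a` with
`f(I) ⊆ B(f(a), r)`: the time at which `f`, started at time `a` in positive direction, leaves the
open ball `B(f(a), r)`. -/
noncomputable def exitTimeRight (f : ℝ → Plane) (a r : ℝ) : ℝ :=
  sSup {b | b ∈ Icc a 1 ∧ ∀ t ∈ Icc a b, f t ∈ Metric.ball (f a) r}

/-- `max K`, the left end point of the longest interval `I` in `[0;1]` around `a` with
`f(I) ⊆ B(f(a), r)`: the time at which `f`, started at time `a` in negative direction, leaves the
open ball `B(f(a), r)`. -/
noncomputable def exitTimeLeft (f : ℝ → Plane) (a r : ℝ) : ℝ :=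
  sInf {b | b ∈ Icc 0 a ∧ ∀ t ∈ Icc b a, f t ∈ Metric.ball (f a) r}

/-- The predicate `Q`: for some rational time `a` and some nondegenerate interval `[r;s]` of radii,
where the closed ball `B(f(a), s)` lies in the open unit square, for every rational radius
`t ∈ [r;s]` at least one of the two points at which `f` leaves `B(f(a), t)` is on the curve
of `g`. -/
def FirstAlternative (f g : ℝ → Plane) : Prop :=
  ∃ a r s : ℚ, (a : ℝ) ∈ Icc (0 : ℝ) 1 ∧ 0 < r ∧ r < s ∧
    Metric.closedBall (f a) s ⊆ openUnitSquare ∧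
    ∀ t : ℚ, t ∈ Icc r s →
      f (exitTimeLeft f a t) ∈ curve g ∨ f (exitTimeRight f a t) ∈ curve g

/-! For a point off the curve of `g`, count modulo 2 the steps of a fine polygon inscribed in `g`
that cross the upward vertical ray from the point. Since `g` starts on the left edge and ends on the
bottom edge, no crossing is gained or lost at its ends, and the parity is stable under refinement
and small perturbation (`crossingParity_perturb`, a summation by parts). It is 1 at `f 0` and 0 at
`f 1`.

If `f` meets `g` at a dyadic time, that point is computable at once. Otherwise, for each dyadic
time, a search finds a precision at which the approximations certify that the point of `f` is off
`g`; counting crossings of a lattice polygon then yields the parity (`exists_computable_side`).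
Bisection with parity 1 on the left and 0 on the right converges to a computable time `t`. Were `f
t` off `g`, the parity would be constant near `t` (`exists_pathParity_eq`), a contradiction. The
case distinction is not effective, but mere existence of a computable point does not need it to be.
-/

/-! ### Computable arithmetic, search and bisection -/

theorem computable_intToNat : Computable Int.toNat := by
  -- The encoding of `ℤ` sends `n` to `2 * n` and `Int.negSucc n` to `2 * n + 1`.
  have h : Primrec fun z : ℤ => if (Encodable.encode z).bodd then 0 else (Encodable.encode z).div2 :=
    Primrec.ite (Primrec.eq.comp (Primrec.nat_bodd.comp Primrec.encode) (Primrec.const true))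
      (Primrec.const 0) (Primrec.nat_div2.comp Primrec.encode)
  refine (h.of_eq fun z => ?_).to_comp
  cases z with
  | ofNat n =>
    have : Encodable.encode (n : ℤ) = 2 * n := rfl
    simp [this, Nat.div2_val]
  | negSucc n =>
    have : Encodable.encode (Int.negSucc n) = 2 * n + 1 := rfl
    simp [this]

theorem computable_natCastInt : Computable (fun n : ℕ => (n : ℤ)) := by
  have h : Primrec fun n : ℕ => 2 * n := Primrec.nat_mul.comp (Primrec.const 2) Primrec.id
  exact (Primrec.encode_iff.1 (h.of_eq fun n => rfl)).to_comp

theorem primrec_natPow : Primrec₂ fun a b : ℕ => a ^ b :=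
  Primrec₂.unpaired'.1 Nat.Primrec.pow

theorem computable_two_pow {α : Type*} [Primcodable α] {f : α → ℕ} (hf : Computable f) :
    Computable fun a => 2 ^ f a :=
  (primrec_natPow.comp (Primrec.const 2) Primrec.id).to_comp.comp hf

theorem Computable.sum_range {α : Type*} [Primcodable α] {f : α → ℕ} {h : α → ℕ → ℕ}
    (hf : Computable f) (hh : Computable₂ h) :
    Computable fun a => ∑ i ∈ Finset.range (f a), h a i := by
  have key : Computable fun a => (Nat.rec 0 (fun i s => s + h a i) (f a) : ℕ) :=
    Computable.nat_rec (h := fun a p => p.2 + h a p.1) hf (Computable.const 0)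
      (Primrec.nat_add.to_comp.comp (Computable.snd.comp Computable.snd)
        (hh.comp Computable.fst (Computable.fst.comp Computable.snd)))
  refine key.of_eq fun a => ?_
  induction f a with
  | zero => rfl
  | succ n ih => rw [Finset.sum_range_succ, ← ih]

/-- Unbounded search for a zero succeeds computably. -/
theorem exists_computable_zero {α : Type*} [Primcodable α] {N : α → ℕ → ℕ}
    (hN : Computable₂ N) (h : ∀ a, ∃ n, N a n = 0) :
    ∃ s : α → ℕ, Computable s ∧ ∀ a, N a (s a) = 0 := by
  have hp : Computable₂ fun a n => decide (N a n = 0) :=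
    (Primrec.eq.decide.comp Primrec.id (Primrec.const 0)).to_comp.comp hN
  have hr : Partrec fun a => Nat.rfind fun n => Part.some (decide (N a n = 0)) :=
    Partrec.rfind hp.partrec₂
  have hd : ∀ a, (Nat.rfind fun n => Part.some (decide (N a n = 0))).Dom := fun a =>
    Nat.rfind_dom.2 ⟨(h a).choose, by simpa using (h a).choose_spec, fun _ => trivial⟩
  refine ⟨fun a => (Nat.rfind fun n => Part.some (decide (N a n = 0))).get (hd a),
    hr.of_eq_tot fun a => Part.get_mem _, fun a => ?_⟩
  simpa using Nat.rfind_spec (Part.get_mem (hd a))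

/-- Left end points (numerators over `2 ^ j`) of the bisection of `[0;1]` guided by `side`. -/
def bisection (side : ℕ × ℕ → ℕ) : ℕ → ℕ
  | 0 => 0
  | j + 1 => 2 * bisection side j + side (2 * bisection side j + 1, j + 1)

theorem computable_bisection {side : ℕ × ℕ → ℕ} (h : Computable side) :
    Computable (bisection side) := by
  have hdouble : Computable fun p : ℕ × ℕ => 2 * p.2 :=
    (Primrec.nat_mul.comp (Primrec.const 2) Primrec.snd).to_comp
  have key : Computable fun n : ℕ =>
      (Nat.rec 0 (fun j k => 2 * k + side (2 * k + 1, j + 1)) n : ℕ) :=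
    Computable.nat_rec (h := fun _ p => 2 * p.2 + side (2 * p.2 + 1, p.1 + 1)) Computable.id
      (Computable.const 0)
      ((Primrec.nat_add.to_comp.comp hdouble (h.comp ((Computable.succ.comp hdouble).pair
        (Computable.succ.comp Computable.fst)))).comp Computable.snd)
  refine key.of_eq fun n => ?_
  induction n with
  | zero => rfl
  | succ n ih => simp only [bisection, ← ih]

/-- Indicator of the lattice points `(A, B)` close to `(U, V)`. -/
def nearIndicator (U V A B : ℕ) : ℕ :=
  if A < U + 40 ∧ U < A + 40 ∧ B < V + 40 ∧ V < B + 40 then 1 else 0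

/-- Indicator of the lattice steps from `(A, B)` to some `(A', B')` that cross the upward vertical
ray from (a point near) `(U, V)`. -/
def crossIndicator (U V A A' B : ℕ) : ℕ :=
  if ((A ≤ U + 3 ∧ U + 3 < A') ∨ (U + 3 < A ∧ A' ≤ U + 3)) ∧ V + 5 < B then 1 else 0

theorem computable_nearIndicator {α : Type*} [Primcodable α] {U V A B : α → ℕ}
    (hU : Computable U) (hV : Computable V) (hA : Computable A) (hB : Computable B) :
    Computable fun a => nearIndicator (U a) (V a) (A a) (B a) := by
  have h : Primrec fun p : ℕ × ℕ × ℕ × ℕ => nearIndicator p.1 p.2.1 p.2.2.1 p.2.2.2 := by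
    have h1 : Primrec fun p : ℕ × ℕ × ℕ × ℕ => p.1 := Primrec.fst
    have h2 : Primrec fun p : ℕ × ℕ × ℕ × ℕ => p.2.1 := Primrec.fst.comp Primrec.snd
    have h3 : Primrec fun p : ℕ × ℕ × ℕ × ℕ => p.2.2.1 :=
      Primrec.fst.comp (Primrec.snd.comp Primrec.snd)
    have h4 : Primrec fun p : ℕ × ℕ × ℕ × ℕ => p.2.2.2 :=
      Primrec.snd.comp (Primrec.snd.comp Primrec.snd)
    have hadd {f : ℕ × ℕ × ℕ × ℕ → ℕ} (hf : Primrec f) : Primrec fun p => f p + 40 :=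
      Primrec.nat_add.comp hf (Primrec.const 40)
    exact Primrec.ite ((Primrec.nat_lt.comp h3 (hadd h1)).and ((Primrec.nat_lt.comp h1 (hadd h3)).and
      ((Primrec.nat_lt.comp h4 (hadd h2)).and (Primrec.nat_lt.comp h2 (hadd h4)))))
      (Primrec.const 1) (Primrec.const 0)
  exact h.to_comp.comp (hU.pair (hV.pair (hA.pair hB)))

theorem computable_crossIndicator {α : Type*} [Primcodable α] {U V A A' B : α → ℕ}
    (hU : Computable U) (hV : Computable V) (hA : Computable A) (hA' : Computable A')
    (hB : Computable B) :
    Computable fun a => crossIndicator (U a) (V a) (A a) (A' a) (B a) := by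
  have h : Primrec fun p : ℕ × ℕ × ℕ × ℕ × ℕ =>
      crossIndicator p.1 p.2.1 p.2.2.1 p.2.2.2.1 p.2.2.2.2 := by
    have h1 : Primrec fun p : ℕ × ℕ × ℕ × ℕ × ℕ => p.1 + 3 :=
      Primrec.nat_add.comp Primrec.fst (Primrec.const 3)
    have h2 : Primrec fun p : ℕ × ℕ × ℕ × ℕ × ℕ => p.2.1 + 5 :=
      Primrec.nat_add.comp (Primrec.fst.comp Primrec.snd) (Primrec.const 5)
    have h3 : Primrec fun p : ℕ × ℕ × ℕ × ℕ × ℕ => p.2.2.1 :=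
      Primrec.fst.comp (Primrec.snd.comp Primrec.snd)
    have h4 : Primrec fun p : ℕ × ℕ × ℕ × ℕ × ℕ => p.2.2.2.1 :=
      Primrec.fst.comp (Primrec.snd.comp (Primrec.snd.comp Primrec.snd))
    have h5 : Primrec fun p : ℕ × ℕ × ℕ × ℕ × ℕ => p.2.2.2.2 :=
      Primrec.snd.comp (Primrec.snd.comp (Primrec.snd.comp Primrec.snd))
    exact Primrec.ite ((((Primrec.nat_le.comp h3 h1).and (Primrec.nat_lt.comp h1 h4)).or
      ((Primrec.nat_lt.comp h1 h3).and (Primrec.nat_le.comp h4 h1))).and (Primrec.nat_lt.comp h2 h5))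
      (Primrec.const 1) (Primrec.const 0)
  exact h.to_comp.comp (hU.pair (hV.pair (hA.pair (hA'.pair hB))))

/-! ### Crossing parity of polygons -/

/-- Indicator of a proposition with values in `ZMod 2`. -/
noncomputable def parityInd (P : Prop) : ZMod 2 := by classical exact if P then 1 else 0

theorem parityInd_true {P : Prop} (h : P) : parityInd P = 1 := by simp [parityInd, h]

theorem parityInd_false {P : Prop} (h : ¬ P) : parityInd P = 0 := by simp [parityInd, h]

theorem parityInd_congr {P Q : Prop} (h : P ↔ Q) : parityInd P = parityInd Q := by rw [propext h]

theorem parityInd_ne {P Q : Prop} (h : parityInd P ≠ parityInd Q) : (P ∧ ¬ Q) ∨ (¬ P ∧ Q) := by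
  by_cases hP : P <;> by_cases hQ : Q <;> simp_all [parityInd]

/-- Put `c = a + a'`. On each step either `c` vanishes at both ends or `u` is constant, so `(c i + c
(i + 1)) * u i = c i * u i + c (i + 1) * u (i + 1)`, which telescopes modulo 2. In the remaining
terms `u` may be replaced by `u'` wherever `a'` changes. -/
theorem sum_parity_add (a a' u u' : ℕ → ZMod 2) (L : ℕ)
    (h1 : ∀ i < L, a i ≠ a' i ∨ a (i + 1) ≠ a' (i + 1) → u i = u (i + 1))
    (h2 : ∀ i < L, a' i ≠ a' (i + 1) → u i = u' i) :
    ∑ i ∈ Finset.range L, (a i + a (i + 1)) * u i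
      = ∑ i ∈ Finset.range L, (a' i + a' (i + 1)) * u' i
        + (a L + a' L) * u L + (a 0 + a' 0) * u 0 := by
  induction L with
  | zero => simp [CharTwo.add_self_eq_zero]
  | succ L ih =>
    rw [Finset.sum_range_succ, Finset.sum_range_succ,
      ih (fun i hi => h1 i (by omega)) fun i hi => h2 i (by omega)]
    have e1 := h1 L (by omega)
    have e2 := h2 L (by omega)
    generalize ∑ i ∈ Finset.range L, (a' i + a' (i + 1)) * u' i = S
    generalize (a 0 + a' 0) * u 0 = R
    have key : (a L + a' L) * u L + (a L + a (L + 1)) * u L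
        = (a' L + a' (L + 1)) * u' L + (a (L + 1) + a' (L + 1)) * u (L + 1) := by
      generalize a L = x, a' L = x', a (L + 1) = y, a' (L + 1) = y', u L = v, u' L = v',
        u (L + 1) = w at e1 e2 ⊢
      clear ih h1 h2
      revert x x' y y' v v' w
      decide
    linear_combination key

/-- Parity of the number of steps of the polygon with vertices `(p i, q i)`, `i ≤ L`, that cross
the upward vertical ray from `(x, y)`. -/
noncomputable def crossingParity (p q : ℕ → ℝ) (x y : ℝ) (L : ℕ) : ZMod 2 :=
  ∑ i ∈ Finset.range L, (parityInd (p i ≤ x) + parityInd (p (i + 1) ≤ x)) * parityInd (y < q i)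

/-- The crossing parity does not change under small perturbations of the polygon and of the point,
if the point is far from the polygon. -/
theorem crossingParity_perturb {p q p' q' : ℕ → ℝ} {x y x' y' ε : ℝ} {L : ℕ} (hε : 0 < ε)
    (hp : ∀ i ≤ L, |p i - p' i| ≤ ε) (hq : ∀ i ≤ L, |q i - q' i| ≤ ε)
    (hx : |x - x'| ≤ ε) (hy : |y - y'| ≤ ε)
    (hps : ∀ i < L, |p i - p (i + 1)| ≤ ε) (hqs : ∀ i < L, |q i - q (i + 1)| ≤ ε)
    (hfar : ∀ i ≤ L, 6 * ε ≤ |p i - x| ∨ 6 * ε ≤ |q i - y|)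
    (h0 : p 0 ≤ x) (h0' : p' 0 ≤ x') (hL : q L ≤ y) :
    crossingParity p q x y L = crossingParity p' q' x' y' L := by
  have hx2 := abs_le.1 hx
  have hy2 := abs_le.1 hy
  -- The perturbation can switch the side of a vertex only within `2 * ε` of the vertical line; such
  -- a vertex must be far from the height `y`.
  have close : ∀ i ≤ L, parityInd (p i ≤ x) ≠ parityInd (p' i ≤ x') → 6 * ε ≤ |q i - y| := by
    intro i hi hne
    refine (hfar i hi).resolve_left fun h => ?_
    have hpi := abs_le.1 (hp i hi)
    have : |p i - x| ≤ 2 * ε := by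
      rcases parityInd_ne hne with ⟨h1, h2⟩ | ⟨h1, h2⟩
      · push Not at h2; rw [abs_le]; constructor <;> linarith
      · push Not at h1; rw [abs_le]; constructor <;> linarith
    linarith
  have step : ∀ i < L, (6 * ε ≤ |q i - y| ∨ 6 * ε ≤ |q (i + 1) - y|) →
      parityInd (y < q i) = parityInd (y < q (i + 1)) := by
    intro i hi h
    have hqi := abs_le.1 (hqs i hi)
    refine parityInd_congr ?_
    rcases h with h | h <;> rcases le_abs.1 h with h | h <;> constructor <;> intro _ <;> linarith
  have := sum_parity_add (fun i => parityInd (p i ≤ x)) (fun i => parityInd (p' i ≤ x'))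
    (fun i => parityInd (y < q i)) (fun i => parityInd (y' < q' i)) L
    (fun i hi h => step i hi (h.imp (close i hi.le) (close (i + 1) hi)))
    (fun i hi h => by
      have hpi := abs_le.1 (hp i hi.le)
      have hpi' := abs_le.1 (hp (i + 1) hi)
      have hsi := abs_le.1 (hps i hi)
      have hqi := abs_le.1 (hq i hi.le)
      -- A perturbed step has length at most `3 * ε`; one `ε` for moving the vertex and one for
      -- moving the line give 5, which is why 6 is demanded in `hfar`.
      have hclose : |p i - x| ≤ 5 * ε := by
        rcases parityInd_ne h with ⟨h1, h2⟩ | ⟨h1, h2⟩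
        · push Not at h2; rw [abs_le]; constructor <;> linarith
        · push Not at h1; rw [abs_le]; constructor <;> linarith
      have hfari := (hfar i hi.le).resolve_left fun h => by linarith
      refine parityInd_congr ?_
      rcases le_abs.1 hfari with h | h <;> constructor <;> intro _ <;> linarith)
  -- Both boundary terms vanish: the first vertices lie on the same side of the line, and the last
  -- vertex is not above `y`.
  simp only [parityInd_true h0, parityInd_true h0', parityInd_false hL.not_gt,
    CharTwo.add_self_eq_zero, mul_zero, zero_mul, add_zero] at this
  exact this

/-- A repeated vertex makes a step that crosses nothing. This lets polygons of consecutive dyadic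
levels be compared vertex by vertex. -/
theorem crossingParity_double (p q : ℕ → ℝ) (x y : ℝ) (L : ℕ) :
    crossingParity (fun i => p (i / 2)) (fun i => q (i / 2)) x y (2 * L)
      = crossingParity p q x y L := by
  induction L with
  | zero => simp [crossingParity]
  | succ L ih =>
    unfold crossingParity at ih ⊢
    have e1 : 2 * L / 2 = L := by omega
    have e2 : (2 * L + 1) / 2 = L := by omega
    have e3 : (2 * L + 1 + 1) / 2 = L + 1 := by omega
    rw [show 2 * (L + 1) = 2 * L + 1 + 1 by ring, Finset.sum_range_succ, Finset.sum_range_succ,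
      ih, Finset.sum_range_succ]
    simp only [e1, e2, e3, CharTwo.add_self_eq_zero, zero_mul, add_zero]

/-! ### Crossing parity of paths -/

/-- Crossing parity for the polygon of the values of a path at the multiples of `1 / 2 ^ k`. -/
noncomputable def pathParity (γ₁ γ₂ : ℝ → ℝ) (x y : ℝ) (k : ℕ) : ZMod 2 :=
  crossingParity (fun i => γ₁ (i / 2 ^ k)) (fun i => γ₂ (i / 2 ^ k)) x y (2 ^ k)

theorem dyadic_mem_Icc {i k : ℕ} (h : i ≤ 2 ^ k) : (i : ℝ) / 2 ^ k ∈ Icc (0 : ℝ) 1 := by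
  refine ⟨by positivity, (div_le_one (by positivity)).2 (by exact_mod_cast h)⟩

theorem abs_dyadic_sub_succ (i k : ℕ) :
    |(i : ℝ) / 2 ^ k - ((i + 1 : ℕ) : ℝ) / 2 ^ k| = 1 / 2 ^ k := by
  rw [← sub_div]
  push_cast
  rw [sub_add_cancel_left, abs_div, abs_neg, abs_one, abs_of_pos (by positivity)]

theorem pathParity_perturb {γ₁ γ₂ : ℝ → ℝ} {x y x' y' ε : ℝ} {k : ℕ} (hε : 0 < ε)
    (h1 : ∀ s ∈ Icc (0 : ℝ) 1, ∀ t ∈ Icc (0 : ℝ) 1, |s - t| ≤ 1 / 2 ^ k → |γ₁ s - γ₁ t| ≤ ε)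
    (h2 : ∀ s ∈ Icc (0 : ℝ) 1, ∀ t ∈ Icc (0 : ℝ) 1, |s - t| ≤ 1 / 2 ^ k → |γ₂ s - γ₂ t| ≤ ε)
    (hfar : ∀ s ∈ Icc (0 : ℝ) 1, 6 * ε ≤ |γ₁ s - x| ∨ 6 * ε ≤ |γ₂ s - y|)
    (hx : |x - x'| ≤ ε) (hy : |y - y'| ≤ ε)
    (h0 : γ₁ 0 ≤ x) (h0' : γ₁ 0 ≤ x') (hL : γ₂ 1 ≤ y) :
    pathParity γ₁ γ₂ x y k = pathParity γ₁ γ₂ x' y' k := by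
  refine crossingParity_perturb hε (by simp [hε.le]) (by simp [hε.le]) hx hy ?_ ?_ ?_ (by simpa)
    (by simpa) (by simpa)
  · exact fun i hi => h1 _ (dyadic_mem_Icc hi.le) _ (dyadic_mem_Icc hi) (abs_dyadic_sub_succ i k).le
  · exact fun i hi => h2 _ (dyadic_mem_Icc hi.le) _ (dyadic_mem_Icc hi) (abs_dyadic_sub_succ i k).le
  · exact fun i hi => hfar _ (dyadic_mem_Icc hi)

theorem pathParity_succ {γ₁ γ₂ : ℝ → ℝ} {x y ε : ℝ} {k : ℕ} (hε : 0 < ε)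
    (h1 : ∀ s ∈ Icc (0 : ℝ) 1, ∀ t ∈ Icc (0 : ℝ) 1, |s - t| ≤ 1 / 2 ^ k → |γ₁ s - γ₁ t| ≤ ε)
    (h2 : ∀ s ∈ Icc (0 : ℝ) 1, ∀ t ∈ Icc (0 : ℝ) 1, |s - t| ≤ 1 / 2 ^ k → |γ₂ s - γ₂ t| ≤ ε)
    (hfar : ∀ s ∈ Icc (0 : ℝ) 1, 6 * ε ≤ |γ₁ s - x| ∨ 6 * ε ≤ |γ₂ s - y|)
    (h0 : γ₁ 0 ≤ x) (hL : γ₂ 1 ≤ y) :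
    pathParity γ₁ γ₂ x y (k + 1) = pathParity γ₁ γ₂ x y k := by
  have hk : (1 : ℝ) / 2 ^ (k + 1) ≤ 1 / 2 ^ k := by
    gcongr <;> norm_num
  have hhalf : ∀ i : ℕ, |(i : ℝ) / 2 ^ (k + 1) - ((i / 2 : ℕ) : ℝ) / 2 ^ k| ≤ 1 / 2 ^ k := by
    intro i
    have e : (i : ℝ) = 2 * ((i / 2 : ℕ) : ℝ) + ((i % 2 : ℕ) : ℝ) := by
      exact_mod_cast (Nat.div_add_mod i 2).symm
    have hm : ((i % 2 : ℕ) : ℝ) ≤ 1 := by exact_mod_cast Nat.le_of_lt_succ (Nat.mod_lt i two_pos)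
    have e2 : (i : ℝ) / 2 ^ (k + 1) - ((i / 2 : ℕ) : ℝ) / 2 ^ k
        = ((i % 2 : ℕ) : ℝ) / 2 ^ (k + 1) := by
      rw [e, pow_succ]; field_simp; ring_nf
    rw [e2, abs_of_nonneg (by positivity)]
    refine le_trans ?_ hk
    gcongr
  have hi2 : ∀ i ≤ 2 ^ (k + 1), i / 2 ≤ 2 ^ k := fun i hi => by rw [pow_succ] at hi; omega
  unfold pathParity
  rw [← crossingParity_double (fun i : ℕ => γ₁ (i / 2 ^ k)), ← pow_succ']
  refine crossingParity_perturb hε ?_ ?_ (by simp [hε.le]) (by simp [hε.le]) ?_ ?_ ?_ (by simpa)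
    (by simpa) (by simpa)
  · exact fun i hi => h1 _ (dyadic_mem_Icc hi) _ (dyadic_mem_Icc (hi2 i hi)) (hhalf i)
  · exact fun i hi => h2 _ (dyadic_mem_Icc hi) _ (dyadic_mem_Icc (hi2 i hi)) (hhalf i)
  · exact fun i hi => h1 _ (dyadic_mem_Icc hi.le) _ (dyadic_mem_Icc hi)
      ((abs_dyadic_sub_succ i _).le.trans hk)
  · exact fun i hi => h2 _ (dyadic_mem_Icc hi.le) _ (dyadic_mem_Icc hi)
      ((abs_dyadic_sub_succ i _).le.trans hk)
  · exact fun i hi => hfar _ (dyadic_mem_Icc hi)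

theorem pathParity_eq_of_le {γ₁ γ₂ : ℝ → ℝ} {x y ε : ℝ} {k l : ℕ} (hε : 0 < ε)
    (h1 : ∀ s ∈ Icc (0 : ℝ) 1, ∀ t ∈ Icc (0 : ℝ) 1, |s - t| ≤ 1 / 2 ^ k → |γ₁ s - γ₁ t| ≤ ε)
    (h2 : ∀ s ∈ Icc (0 : ℝ) 1, ∀ t ∈ Icc (0 : ℝ) 1, |s - t| ≤ 1 / 2 ^ k → |γ₂ s - γ₂ t| ≤ ε)
    (hfar : ∀ s ∈ Icc (0 : ℝ) 1, 6 * ε ≤ |γ₁ s - x| ∨ 6 * ε ≤ |γ₂ s - y|)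
    (h0 : γ₁ 0 ≤ x) (hL : γ₂ 1 ≤ y) (hkl : k ≤ l) :
    pathParity γ₁ γ₂ x y l = pathParity γ₁ γ₂ x y k := by
  induction l, hkl using Nat.le_induction with
  | base => rfl
  | succ l hl ih =>
    have hle : (1 : ℝ) / 2 ^ l ≤ 1 / 2 ^ k := by
      gcongr; norm_num
    rw [← ih]
    exact pathParity_succ hε (fun s hs t ht h => h1 s hs t ht (h.trans hle))
      (fun s hs t ht h => h2 s hs t ht (h.trans hle)) hfar h0 hL

/-- For a path starting on the left edge of the unit square and then staying to the right of it,
every point on the left edge below the start has odd parity. -/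
theorem pathParity_eq_one {γ₁ γ₂ : ℝ → ℝ} {x y : ℝ} (h0 : γ₁ 0 ≤ x)
    (hpos : ∀ t ∈ Ioc (0 : ℝ) 1, x < γ₁ t) (hy : y < γ₂ 0) (k : ℕ) :
    pathParity γ₁ γ₂ x y k = 1 := by
  unfold pathParity crossingParity
  -- Only vertex 0 satisfies `γ₁ ≤ x`, so only the first step crosses the line.
  rw [Finset.sum_eq_single 0]
  · have : ¬ γ₁ (((0 + 1 : ℕ) : ℝ) / 2 ^ k) ≤ x := by
      refine (hpos _ ⟨by positivity, (dyadic_mem_Icc (Nat.one_le_two_pow)).2⟩).not_ge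
    rw [parityInd_false this, parityInd_true (by simpa), parityInd_true (by simpa)]
    simp
  · intro i hi hi0
    rw [Finset.mem_range] at hi
    have hi' : 0 < i := Nat.pos_of_ne_zero hi0
    rw [parityInd_false (hpos _ ⟨by positivity, (dyadic_mem_Icc hi.le).2⟩).not_ge,
      parityInd_false (hpos _ ⟨by positivity, (dyadic_mem_Icc hi).2⟩).not_ge]
    simp
  · intro h
    simp at h

theorem pathParity_eq_zero {γ₁ γ₂ : ℝ → ℝ} {x y : ℝ}
    (h : ∀ t ∈ Icc (0 : ℝ) 1, γ₂ t ≤ y) (k : ℕ) : pathParity γ₁ γ₂ x y k = 0 := by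
  unfold pathParity crossingParity
  refine Finset.sum_eq_zero fun i hi => ?_
  rw [parityInd_false (h _ (dyadic_mem_Icc (Finset.mem_range.1 hi).le)).not_gt, mul_zero]

/-! ### Approximating computable functions -/

theorem IsComputableOnUnitInterval.exists_modulus {h : ℝ → ℝ} (hh : IsComputableOnUnitInterval h)
    {ε : ℝ} (hε : 0 < ε) :
    ∃ k : ℕ, ∀ s ∈ Icc (0 : ℝ) 1, ∀ t ∈ Icc (0 : ℝ) 1, |s - t| ≤ 1 / 2 ^ k → |h s - h t| ≤ ε := by
  obtain ⟨m, -, hm⟩ := hh.2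
  obtain ⟨n, hn⟩ := exists_pow_lt_of_lt_one hε (by norm_num : (1 / 2 : ℝ) < 1)
  refine ⟨m n, fun s hs t ht hst => (hm n s hs t ht hst).trans ?_⟩
  rw [← one_div_pow]
  exact hn.le

theorem IsComputableOnUnitInterval.continuousOn {h : ℝ → ℝ} (hh : IsComputableOnUnitInterval h) :
    ContinuousOn h (Icc 0 1) := by
  rw [Metric.continuousOn_iff]
  intro b hb ε hε
  obtain ⟨k, hk⟩ := hh.exists_modulus (half_pos hε)
  refine ⟨1 / 2 ^ k, by positivity, fun a ha hab => ?_⟩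
  rw [Real.dist_eq] at hab ⊢
  linarith [hk a ha b hb hab.le]

/-- Since `x` is nonnegative, raising a negative approximation to 0 cannot spoil the bound. -/
theorem abs_sub_toNat_div_le {x d : ℝ} {z : ℤ} (hd : 0 ≤ d) (hx : 0 ≤ x) (h : |x - z / d| ≤ 1 / d) :
    |x - z.toNat / d| ≤ 1 / d := by
  rcases le_total 0 z with hz | hz
  · have : ((z.toNat : ℕ) : ℝ) = z := by exact_mod_cast Int.toNat_of_nonneg hz
    rwa [this]
  · have hz' : (z : ℝ) / d ≤ 0 := div_nonpos_of_nonpos_of_nonneg (by exact_mod_cast hz) hd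
    rw [Int.toNat_of_nonpos hz]
    rw [abs_le] at h ⊢
    constructor <;> simp only [Nat.cast_zero, zero_div] <;> linarith

theorem IsComputableOnUnitInterval.exists_nat_approx {h : ℝ → ℝ}
    (hh : IsComputableOnUnitInterval h) (h0 : ∀ t ∈ Icc (0 : ℝ) 1, 0 ≤ h t) :
    ∃ A : ℕ × ℕ × ℕ → ℕ, Computable A ∧ ∀ k j n : ℕ, k ≤ 2 ^ j →
      |h ((k : ℝ) / 2 ^ j) - A (k, 2 ^ j, n) / 2 ^ n| ≤ 1 / 2 ^ n := by
  obtain ⟨z, hz, hz'⟩ := hh.1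
  refine ⟨fun p => (z p).toNat, computable_intToNat.comp hz, fun k j n hk =>
    abs_sub_toNat_div_le (by positivity) (h0 _ (dyadic_mem_Icc hk)) ?_⟩
  simpa using hz' k (2 ^ j) n (by positivity) hk

theorem IsComputableOnUnitInterval.isComputableReal_dyadic {h : ℝ → ℝ}
    (hh : IsComputableOnUnitInterval h) {k j : ℕ} (hk : k ≤ 2 ^ j) :
    IsComputableReal (h ((k : ℝ) / 2 ^ j)) := by
  obtain ⟨z, hz, hz'⟩ := hh.1
  refine ⟨fun n => z (k, 2 ^ j, n), hz.comp ((Computable.const k).pair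
    ((Computable.const (2 ^ j)).pair Computable.id)), fun n => ?_⟩
  simpa using hz' k (2 ^ j) n (by positivity) hk

/-- A computable function maps a computable argument to a computable value. -/
theorem IsComputableOnUnitInterval.isComputableReal_of_dyadic_approx {h : ℝ → ℝ}
    (hh : IsComputableOnUnitInterval h) (h0 : ∀ t ∈ Icc (0 : ℝ) 1, 0 ≤ h t) {t : ℝ} {K : ℕ → ℕ}
    (hK : Computable K) (hKle : ∀ j, K j ≤ 2 ^ j) (ht : t ∈ Icc (0 : ℝ) 1)
    (hKt : ∀ j, |(K j : ℝ) / 2 ^ j - t| ≤ 1 / 2 ^ j) : IsComputableReal (h t) := by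
  obtain ⟨A, hA, hA'⟩ := hh.exists_nat_approx h0
  obtain ⟨m, hm, hm'⟩ := hh.2
  have hj : Computable fun n => m (n + 2) :=
    hm.comp (Primrec.nat_add.comp Primrec.id (Primrec.const 2)).to_comp
  have hw : Computable fun n => A (K (m (n + 2)), 2 ^ m (n + 2), n + 2) :=
    hA.comp ((hK.comp hj).pair ((computable_two_pow hj).pair
      (Primrec.nat_add.comp Primrec.id (Primrec.const 2)).to_comp))
  have hround : Computable fun w : ℕ => (w + 2) / 4 :=
    (Primrec.nat_div.comp (Primrec.nat_add.comp Primrec.id (Primrec.const 2))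
      (Primrec.const 4)).to_comp
  refine ⟨fun n => (((A (K (m (n + 2)), 2 ^ m (n + 2), n + 2) + 2) / 4 : ℕ) : ℤ),
    computable_natCastInt.comp (hround.comp hw), fun n => ?_⟩
  beta_reduce
  have e1 := hA' _ (m (n + 2)) (n + 2) (hKle (m (n + 2)))
  have e2 := hm' (n + 2) _ (dyadic_mem_Icc (hKle (m (n + 2)))) t ht (hKt _)
  generalize A (K (m (n + 2)), 2 ^ m (n + 2), n + 2) = w at e1 ⊢
  generalize h ((K (m (n + 2)) : ℝ) / 2 ^ m (n + 2)) = y at e1 e2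
  have hd : (0 : ℝ) < 2 ^ n := by positivity
  have e3 : ((((w + 2) / 4 : ℕ) : ℤ) : ℝ) * 4 - w ≤ 2 := by
    have : (w + 2) / 4 * 4 ≤ w + 2 := by omega
    have : (((w + 2) / 4 : ℕ) : ℝ) * 4 ≤ w + 2 := by exact_mod_cast this
    rw [Int.cast_natCast]; linarith
  have e4 : -2 ≤ ((((w + 2) / 4 : ℕ) : ℤ) : ℝ) * 4 - w := by
    have : w ≤ (w + 2) / 4 * 4 + 2 := by omega
    have : (w : ℝ) ≤ (((w + 2) / 4 : ℕ) : ℝ) * 4 + 2 := by exact_mod_cast this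
    rw [Int.cast_natCast]; linarith
  generalize ((((w + 2) / 4 : ℕ) : ℤ) : ℝ) = v at *
  rw [pow_add, abs_le] at e1 e2
  rw [abs_le]
  have hinv : (1 : ℝ) / (2 ^ n * 2 ^ 2) = 1 / 2 ^ n / 4 := by field_simp; norm_num
  have hw' : (w : ℝ) / (2 ^ n * 2 ^ 2) = v / 2 ^ n - (v * 4 - w) * (1 / 2 ^ n) / 4 := by
    field_simp; ring
  rw [hinv] at e1 e2
  rw [hw'] at e1
  have hp : (0 : ℝ) < 1 / 2 ^ n := by positivity
  have e5 := mul_le_mul_of_nonneg_right e3 hp.le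
  have e6 := mul_le_mul_of_nonneg_right e4 hp.le
  constructor <;> linarith

/-! ### Deciding the parity at dyadic times -/

/-- By compactness, the maximum-norm distance to the point attains its minimum on the path. -/
theorem exists_dist_bound {γ₁ γ₂ : ℝ → ℝ} {x y : ℝ} (h1 : ContinuousOn γ₁ (Icc 0 1))
    (h2 : ContinuousOn γ₂ (Icc 0 1)) (h : ¬ ∃ s ∈ Icc (0 : ℝ) 1, x = γ₁ s ∧ y = γ₂ s) :
    ∃ δ > 0, ∀ s ∈ Icc (0 : ℝ) 1, δ ≤ |γ₁ s - x| ∨ δ ≤ |γ₂ s - y| := by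
  have hc : ContinuousOn (fun s => max |γ₁ s - x| |γ₂ s - y|) (Icc 0 1) :=
    ContinuousOn.sup (h1.sub continuousOn_const).abs (h2.sub continuousOn_const).abs
  obtain ⟨s, hs, hmin⟩ := isCompact_Icc.exists_isMinOn (nonempty_Icc.2 zero_le_one) hc
  refine ⟨max |γ₁ s - x| |γ₂ s - y|, ?_, fun t ht => le_max_iff.1 (hmin ht)⟩
  by_contra hle
  push Not at hle
  have h1' := abs_nonpos_iff.1 ((le_max_left _ _).trans hle)
  have h2' := abs_nonpos_iff.1 ((le_max_right _ _).trans hle)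
  exact h ⟨s, hs, by linarith, by linarith⟩

theorem natCast_crossIndicator (U V A A' B : ℕ) :
    ((crossIndicator U V A A' B : ℕ) : ZMod 2)
      = (parityInd (A ≤ U + 3) + parityInd (A' ≤ U + 3)) * parityInd (V + 5 < B) := by
  have h11 : (1 : ZMod 2) + 1 = 0 := by decide
  by_cases h1 : A ≤ U + 3 <;> by_cases h2 : A' ≤ U + 3 <;> by_cases h3 : V + 5 < B <;>
    simp [crossIndicator, parityInd, h1, h2, h3, not_lt.2, not_le.1, h11]

theorem sum_crossIndicator_eq_crossingParity {A B : ℕ → ℕ} {U V : ℕ} {d : ℝ} (hd : 0 < d) (L : ℕ) :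
    ((∑ i ∈ Finset.range L, crossIndicator U V (A i) (A (i + 1)) (B i) : ℕ) : ZMod 2)
      = crossingParity (fun i => A i / d) (fun i => B i / d) ((U + 3) / d) ((V + 5) / d) L := by
  rw [Nat.cast_sum]
  refine Finset.sum_congr rfl fun i _ => ?_
  rw [natCast_crossIndicator]
  simp only [div_le_div_iff_of_pos_right hd, div_lt_div_iff_of_pos_right hd]
  norm_cast

/-- Two rounding errors reduce the cutoff of 40 lattice units to 38. This is the soundness of the
search. -/
theorem far_of_nearIndicator_eq_zero {a b x y d : ℝ} {U V A B : ℕ} (hd : 0 < d)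
    (hA : |a - A / d| ≤ 1 / d) (hB : |b - B / d| ≤ 1 / d) (hU : |x - U / d| ≤ 1 / d)
    (hV : |y - V / d| ≤ 1 / d) (h : nearIndicator U V A B = 0) :
    38 / d ≤ |a - x| ∨ 38 / d ≤ |b - y| := by
  have aux : ∀ {a x : ℝ} {U A : ℕ}, |a - A / d| ≤ 1 / d → |x - U / d| ≤ 1 / d →
      (U + 40 ≤ A ∨ A + 40 ≤ U) → 38 / d ≤ |a - x| := by
    intro a x U A hA hU h
    rw [abs_le] at hA hU
    have e : (38 : ℝ) / d = 40 / d - 2 * (1 / d) := by ring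
    rcases h with h | h
    · have h' : ((U : ℝ) + 40) / d ≤ A / d := by gcongr; exact_mod_cast h
      rw [add_div] at h'
      refine le_trans ?_ (le_abs_self _)
      linarith
    · have h' : ((A : ℝ) + 40) / d ≤ U / d := by gcongr; exact_mod_cast h
      rw [add_div] at h'
      refine le_trans ?_ (neg_le_abs _)
      linarith
  have h' : ¬ (A < U + 40 ∧ U < A + 40 ∧ B < V + 40 ∧ V < B + 40) := by
    intro h'
    simp [nearIndicator, h'] at h
  by_cases hAU : U + 40 ≤ A ∨ A + 40 ≤ U
  · exact Or.inl (aux hA hU hAU)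
  · exact Or.inr (aux hB hV (by omega))

/-- The same two errors, now added to 40. This makes the search terminate when the point is off the
path. -/
theorem nearIndicator_eq_zero_of_far {a b x y d : ℝ} {U V A B : ℕ} (hd : 0 < d)
    (hA : |a - A / d| ≤ 1 / d) (hB : |b - B / d| ≤ 1 / d) (hU : |x - U / d| ≤ 1 / d)
    (hV : |y - V / d| ≤ 1 / d) (h : 42 / d ≤ |a - x| ∨ 42 / d ≤ |b - y|) :
    nearIndicator U V A B = 0 := by
  have aux : ∀ {a x : ℝ} {U A : ℕ}, |a - A / d| ≤ 1 / d → |x - U / d| ≤ 1 / d →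
      A < U + 40 → U < A + 40 → |a - x| < 42 / d := by
    intro a x U A hA hU h1 h2
    rw [abs_le] at hA hU
    have e : (42 : ℝ) / d = 40 / d + 2 * (1 / d) := by ring
    have h1' : (A : ℝ) / d < ((U : ℝ) + 40) / d := by gcongr; exact_mod_cast h1
    have h2' : (U : ℝ) / d < ((A : ℝ) + 40) / d := by gcongr; exact_mod_cast h2
    rw [add_div] at h1' h2'
    rw [abs_lt]
    constructor <;> linarith
  rw [nearIndicator, if_neg]
  rintro ⟨h1, h2, h3, h4⟩
  rcases h with h | h
  · exact (aux hA hU h1 h2).not_ge h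
  · exact (aux hB hV h3 h4).not_ge h

/-- The crossing count of a lattice polygon that approximates a path determines the eventual
crossing parity of the path. -/
theorem pathParity_eq_sum_crossIndicator {γ₁ γ₂ : ℝ → ℝ} {x y : ℝ} {A B : ℕ → ℕ} {U V n k l : ℕ}
    (h1 : ∀ s ∈ Icc (0 : ℝ) 1, ∀ t ∈ Icc (0 : ℝ) 1, |s - t| ≤ 1 / 2 ^ k → |γ₁ s - γ₁ t| ≤ 1 / 2 ^ n)
    (h2 : ∀ s ∈ Icc (0 : ℝ) 1, ∀ t ∈ Icc (0 : ℝ) 1, |s - t| ≤ 1 / 2 ^ k → |γ₂ s - γ₂ t| ≤ 1 / 2 ^ n)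
    (hA : ∀ i : ℕ, i ≤ 2 ^ k → |γ₁ (i / 2 ^ k) - A i / 2 ^ n| ≤ 1 / 2 ^ n)
    (hB : ∀ i : ℕ, i ≤ 2 ^ k → |γ₂ (i / 2 ^ k) - B i / 2 ^ n| ≤ 1 / 2 ^ n)
    (hU : |x - U / 2 ^ n| ≤ 1 / 2 ^ n) (hV : |y - V / 2 ^ n| ≤ 1 / 2 ^ n)
    (hx : 0 ≤ x) (hy : 0 ≤ y) (h0 : γ₁ 0 = 0) (hL : γ₂ 1 = 0)
    (hnear : ∀ i ≤ 2 ^ k, nearIndicator U V (A i) (B i) = 0) (hkl : k ≤ l) :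
    pathParity γ₁ γ₂ x y l
      = ((∑ i ∈ Finset.range (2 ^ k), crossIndicator U V (A i) (A (i + 1)) (B i) : ℕ) : ZMod 2) := by
  have hd : (0 : ℝ) < 2 ^ n := by positivity
  have hp : (0 : ℝ) < 1 / 2 ^ n := by positivity
  -- The factor 6 covers the largest shift in `crossIndicator`, 5 lattice units, and one unit of
  -- rounding.
  have hε : (0 : ℝ) < 6 * (1 / 2 ^ n) := by positivity
  have hfar : ∀ i : ℕ, i ≤ 2 ^ k → 38 / 2 ^ n ≤ |γ₁ (i / 2 ^ k) - x| ∨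
      38 / 2 ^ n ≤ |γ₂ (i / 2 ^ k) - y| :=
    fun i hi => far_of_nearIndicator_eq_zero hd (hA i hi) (hB i hi) hU hV (hnear i hi)
  have e38 : (38 : ℝ) / 2 ^ n = 38 * (1 / 2 ^ n) := by ring
  rw [e38] at hfar
  have hfar' : ∀ s ∈ Icc (0 : ℝ) 1,
      6 * (6 * (1 / 2 ^ n)) ≤ |γ₁ s - x| ∨ 6 * (6 * (1 / 2 ^ n)) ≤ |γ₂ s - y| := by
    intro s hs
    have hi : ⌊s * 2 ^ k⌋₊ ≤ 2 ^ k := by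
      refine Nat.floor_le_of_le ?_
      push_cast
      exact mul_le_of_le_one_left (by positivity) hs.2
    have hs' : |s - (⌊s * 2 ^ k⌋₊ : ℝ) / 2 ^ k| ≤ 1 / 2 ^ k := by
      have hk : (0 : ℝ) < 2 ^ k := by positivity
      have f1 := Nat.floor_le (mul_nonneg hs.1 hk.le)
      have f2 := (Nat.lt_floor_add_one (s * 2 ^ k)).le
      rw [← div_le_iff₀ hk] at f1
      rw [← le_div_iff₀ hk, add_div] at f2
      rw [abs_le]
      constructor <;> linarith [show (0 : ℝ) < 1 / 2 ^ k by positivity]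
    have g1 := h1 s hs _ (dyadic_mem_Icc hi) hs'
    have g2 := h2 s hs _ (dyadic_mem_Icc hi) hs'
    have t1 := abs_sub_abs_le_abs_sub (γ₁ (⌊s * 2 ^ k⌋₊ / 2 ^ k) - x) (γ₁ s - x)
    have t2 := abs_sub_abs_le_abs_sub (γ₂ (⌊s * 2 ^ k⌋₊ / 2 ^ k) - y) (γ₂ s - y)
    rw [sub_sub_sub_cancel_right, abs_sub_comm _ (γ₁ s)] at t1
    rw [sub_sub_sub_cancel_right, abs_sub_comm _ (γ₂ s)] at t2
    rcases hfar _ hi with h | h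
    · left; linarith
    · right; linarith
  rw [pathParity_eq_of_le hε (fun s hs t ht h => (h1 s hs t ht h).trans (by linarith))
    (fun s hs t ht h => (h2 s hs t ht h).trans (by linarith)) hfar' (by rwa [h0]) (by rwa [hL]) hkl,
    sum_crossIndicator_eq_crossingParity hd]
  refine crossingParity_perturb hε (fun i hi => (hA i hi).trans (by linarith))
    (fun i hi => (hB i hi).trans (by linarith)) ?_ ?_ ?_ ?_
    (fun i hi => hfar' _ (dyadic_mem_Icc hi)) (by simpa [h0]) ?_ (by simpa [hL])
  · rw [abs_le] at hU ⊢
    rw [add_div, show (3 : ℝ) / 2 ^ n = 3 * (1 / 2 ^ n) by ring]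
    constructor <;> linarith
  · rw [abs_le] at hV ⊢
    rw [add_div, show (5 : ℝ) / 2 ^ n = 5 * (1 / 2 ^ n) by ring]
    constructor <;> linarith
  · exact fun i hi => (h1 _ (dyadic_mem_Icc hi.le) _ (dyadic_mem_Icc hi)
      (abs_dyadic_sub_succ i k).le).trans (by linarith)
  · exact fun i hi => (h2 _ (dyadic_mem_Icc hi.le) _ (dyadic_mem_Icc hi)
      (abs_dyadic_sub_succ i k).le).trans (by linarith)
  -- Rounding gives `A 0 ≤ 1`, so the shift by 3 keeps the first lattice vertex to the left of the
  -- ray.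
  · have := (abs_le.1 (hA 0 (Nat.zero_le _))).1
    simp only [Nat.cast_zero, zero_div, h0, zero_sub, neg_le_neg_iff] at this
    refine this.trans ?_
    gcongr
    linarith [(Nat.cast_nonneg U : (0 : ℝ) ≤ U)]

/-- If no dyadic point of the path `(f₁, f₂)` is on the path `(g₁, g₂)`, then the eventual crossing
parity is computable at the dyadic points of `(f₁, f₂)`. -/
theorem exists_computable_side {f₁ f₂ g₁ g₂ : ℝ → ℝ}
    (hf₁ : IsComputableOnUnitInterval f₁) (hf₂ : IsComputableOnUnitInterval f₂)
    (hg₁ : IsComputableOnUnitInterval g₁) (hg₂ : IsComputableOnUnitInterval g₂)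
    (pf₁ : ∀ t ∈ Icc (0 : ℝ) 1, 0 ≤ f₁ t) (pf₂ : ∀ t ∈ Icc (0 : ℝ) 1, 0 ≤ f₂ t)
    (pg₁ : ∀ t ∈ Icc (0 : ℝ) 1, 0 ≤ g₁ t) (pg₂ : ∀ t ∈ Icc (0 : ℝ) 1, 0 ≤ g₂ t)
    (h0 : g₁ 0 = 0) (hL : g₂ 1 = 0)
    (hdisj : ∀ k j : ℕ, k ≤ 2 ^ j →
      ¬ ∃ s ∈ Icc (0 : ℝ) 1, f₁ (k / 2 ^ j) = g₁ s ∧ f₂ (k / 2 ^ j) = g₂ s) :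
    ∃ side : ℕ × ℕ → ℕ, Computable side ∧ (∀ p, side p < 2) ∧ ∀ k j : ℕ, k ≤ 2 ^ j →
      ∃ l₀, ∀ l ≥ l₀,
        pathParity g₁ g₂ (f₁ (k / 2 ^ j)) (f₂ (k / 2 ^ j)) l = (side (k, j) : ZMod 2) := by
  obtain ⟨U, hU, hU'⟩ := hf₁.exists_nat_approx pf₁
  obtain ⟨V, hV, hV'⟩ := hf₂.exists_nat_approx pf₂
  obtain ⟨A, hA, hA'⟩ := hg₁.exists_nat_approx pg₁
  obtain ⟨B, hB, hB'⟩ := hg₂.exists_nat_approx pg₂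
  obtain ⟨m₁, hm₁, hm₁'⟩ := hg₁.2
  obtain ⟨m₂, hm₂, hm₂'⟩ := hg₂.2
  -- the query `q = (((k, j), n), i)`: dyadic point, precision and index of the vertex
  let m : ℕ → ℕ := fun n => m₁ n + m₂ n
  have hm : Computable m := Primrec.nat_add.to_comp.comp hm₁ hm₂
  -- The numerator is clamped to `2 ^ j` so that the search terminates on every input.
  let c : (ℕ × ℕ) × ℕ → ℕ × ℕ × ℕ := fun q => (min q.1.1 (2 ^ q.1.2), 2 ^ q.1.2, q.2)
  have hc : Computable c := by
    have h2 : Computable fun q : (ℕ × ℕ) × ℕ => 2 ^ q.1.2 :=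
      computable_two_pow (Computable.snd.comp Computable.fst)
    exact (Primrec.nat_min.to_comp.comp (Computable.fst.comp Computable.fst) h2).pair
      (h2.pair Computable.snd)
  let v : ((ℕ × ℕ) × ℕ) × ℕ → ℕ × ℕ × ℕ := fun q => (q.2, 2 ^ m q.1.2, q.1.2)
  have hv : Computable v :=
    Computable.snd.pair ((computable_two_pow (hm.comp (Computable.snd.comp Computable.fst))).pair
      (Computable.snd.comp Computable.fst))
  let v' : ((ℕ × ℕ) × ℕ) × ℕ → ℕ × ℕ × ℕ := fun q => (q.2 + 1, 2 ^ m q.1.2, q.1.2)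
  have hv' : Computable v' :=
    (Computable.succ.comp Computable.snd).pair
      ((computable_two_pow (hm.comp (Computable.snd.comp Computable.fst))).pair
      (Computable.snd.comp Computable.fst))
  -- `N p n` counts the vertices not certified far at precision `n`; a zero certifies the whole
  -- polygon.
  let N : ℕ × ℕ → ℕ → ℕ := fun p n => ∑ i ∈ Finset.range (2 ^ m n + 1),
    nearIndicator (U (c (p, n))) (V (c (p, n))) (A (v ((p, n), i))) (B (v ((p, n), i)))
  let X : (ℕ × ℕ) × ℕ → ℕ := fun q => ∑ i ∈ Finset.range (2 ^ m q.2),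
    crossIndicator (U (c q)) (V (c q)) (A (v (q, i))) (A (v' (q, i))) (B (v (q, i)))
  have hcf : Computable fun q : ((ℕ × ℕ) × ℕ) × ℕ => c q.1 := hc.comp Computable.fst
  have hN : Computable₂ N := by
    have : Computable fun q : (ℕ × ℕ) × ℕ => ∑ i ∈ Finset.range (2 ^ m q.2 + 1),
        nearIndicator (U (c q)) (V (c q)) (A (v (q, i))) (B (v (q, i))) :=
      Computable.sum_range
        (Computable.succ.comp (computable_two_pow (hm.comp Computable.snd)))
        (computable_nearIndicator (hU.comp hcf) (hV.comp hcf) (hA.comp hv) (hB.comp hv)).to₂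
    exact this
  have hX : Computable X :=
    Computable.sum_range (computable_two_pow (hm.comp Computable.snd))
      (computable_crossIndicator (hU.comp hcf) (hV.comp hcf) (hA.comp hv) (hA.comp hv')
        (hB.comp hv)).to₂
  have hexists : ∀ p, ∃ n, N p n = 0 := by
    rintro ⟨k, j⟩
    have hk : min k (2 ^ j) ≤ 2 ^ j := min_le_right _ _
    obtain ⟨δ, hδ, hfar⟩ := exists_dist_bound hg₁.continuousOn hg₂.continuousOn (hdisj _ j hk)
    obtain ⟨n, hn⟩ := exists_pow_lt_of_lt_one (show 0 < δ / 42 by positivity)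
      (by norm_num : (1 / 2 : ℝ) < 1)
    have hn' : 42 / 2 ^ n ≤ δ := by
      rw [one_div_pow] at hn
      have : (42 : ℝ) / 2 ^ n = 42 * (1 / 2 ^ n) := by ring
      linarith
    refine ⟨n, Finset.sum_eq_zero fun i hi => ?_⟩
    have hi' : i ≤ 2 ^ m n := by rw [Finset.mem_range] at hi; omega
    exact nearIndicator_eq_zero_of_far (by positivity) (hA' i (m n) n hi') (hB' i (m n) n hi')
      (hU' _ j n hk) (hV' _ j n hk)
      ((hfar _ (dyadic_mem_Icc hi')).imp (fun h => hn'.trans h) fun h => hn'.trans h)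
  obtain ⟨s, hs, hs'⟩ := exists_computable_zero hN hexists
  refine ⟨fun p => X (p, s p) % 2,
    (Primrec.nat_mod.comp Primrec.id (Primrec.const 2)).to_comp.comp
      (hX.comp (Computable.id.pair hs)), fun p => Nat.mod_lt _ two_pos, fun k j hk => ?_⟩
  have hk' : min k (2 ^ j) = k := min_eq_left hk
  refine ⟨m (s (k, j)), fun l hl => ?_⟩
  rw [ZMod.natCast_mod]
  have hz := hs' (k, j)
  have hXe : X ((k, j), s (k, j)) = ∑ i ∈ Finset.range (2 ^ m (s (k, j))),
      crossIndicator (U (k, 2 ^ j, s (k, j))) (V (k, 2 ^ j, s (k, j)))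
        (A (i, 2 ^ m (s (k, j)), s (k, j))) (A (i + 1, 2 ^ m (s (k, j)), s (k, j)))
        (B (i, 2 ^ m (s (k, j)), s (k, j))) := by
    simp only [X, c, v, v', hk']
  simp only [N, c, v, hk'] at hz
  rw [hXe]
  generalize s (k, j) = n at hz hl ⊢
  have hle₁ : (1 : ℝ) / 2 ^ m n ≤ 1 / 2 ^ m₁ n :=
    one_div_le_one_div_of_le (by positivity) (pow_le_pow_right₀ one_le_two (Nat.le_add_right _ _))
  have hle₂ : (1 : ℝ) / 2 ^ m n ≤ 1 / 2 ^ m₂ n :=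
    one_div_le_one_div_of_le (by positivity) (pow_le_pow_right₀ one_le_two (Nat.le_add_left _ _))
  have hmem := dyadic_mem_Icc hk
  exact pathParity_eq_sum_crossIndicator
    (A := fun i => A (i, 2 ^ m n, n)) (B := fun i => B (i, 2 ^ m n, n))
    (fun a ha b hb h => hm₁' n a ha b hb (h.trans hle₁))
    (fun a ha b hb h => hm₂' n a ha b hb (h.trans hle₂))
    (fun i hi => hA' i (m n) n hi) (fun i hi => hB' i (m n) n hi) (hU' k j n hk) (hV' k j n hk)
    (pf₁ _ hmem) (pf₂ _ hmem) h0 hL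
    (fun i hi => Finset.sum_eq_zero_iff.1 hz i (Finset.mem_range.2 (by omega))) hl

/-! ### Bisection and the intersection point -/

theorem exists_bisection_limit {K : ℕ → ℕ} (hK : ∀ j, K (j + 1) = 2 * K j ∨ K (j + 1) = 2 * K j + 1) :
    ∃ t : ℝ, ∀ j, (K j : ℝ) / 2 ^ j ≤ t ∧ t ≤ ((K j + 1 : ℕ) : ℝ) / 2 ^ j := by
  have hd : ∀ j : ℕ, ∀ a : ℝ, a / 2 ^ j = 2 * a / 2 ^ (j + 1) := fun j a => by
    rw [pow_succ]; field_simp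
  have hmono : Monotone fun j => (K j : ℝ) / 2 ^ j := by
    refine monotone_nat_of_le_succ fun j => ?_
    rw [hd j]
    gcongr
    have : 2 * K j ≤ K (j + 1) := by have := hK j; omega
    exact_mod_cast this
  have hanti : Antitone fun j => ((K j + 1 : ℕ) : ℝ) / 2 ^ j := by
    refine antitone_nat_of_succ_le fun j => ?_
    rw [hd j]
    gcongr
    have : K (j + 1) + 1 ≤ 2 * (K j + 1) := by have := hK j; omega
    exact_mod_cast this
  have hle : ∀ i j, (K i : ℝ) / 2 ^ i ≤ ((K j + 1 : ℕ) : ℝ) / 2 ^ j := fun i j =>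
    (hmono (le_max_left i j)).trans (le_trans
      (by beta_reduce; gcongr; exact Nat.le_succ _) (hanti (le_max_right i j)))
  have hbdd : BddAbove (range fun j => (K j : ℝ) / 2 ^ j) :=
    ⟨_, forall_mem_range.2 fun i => hle i 0⟩
  exact ⟨⨆ j, (K j : ℝ) / 2 ^ j, fun j => ⟨le_ciSup hbdd j, ciSup_le fun i => hle i j⟩⟩

/-- The eventual crossing parity is locally constant along `(f₁, f₂)` off `(g₁, g₂)`. -/
theorem exists_pathParity_eq {f₁ f₂ g₁ g₂ : ℝ → ℝ}
    (hf₁ : IsComputableOnUnitInterval f₁) (hf₂ : IsComputableOnUnitInterval f₂)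
    (hg₁ : IsComputableOnUnitInterval g₁) (hg₂ : IsComputableOnUnitInterval g₂)
    (pf₁ : ∀ t ∈ Icc (0 : ℝ) 1, 0 ≤ f₁ t) (pf₂ : ∀ t ∈ Icc (0 : ℝ) 1, 0 ≤ f₂ t)
    (h0 : g₁ 0 = 0) (hL : g₂ 1 = 0) {t : ℝ} (ht : t ∈ Icc (0 : ℝ) 1)
    (hdisj : ¬ ∃ s ∈ Icc (0 : ℝ) 1, f₁ t = g₁ s ∧ f₂ t = g₂ s) :
    ∃ k : ℕ, ∀ l ≥ k, ∀ a ∈ Icc (0 : ℝ) 1, |t - a| ≤ 1 / 2 ^ k →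
      pathParity g₁ g₂ (f₁ t) (f₂ t) l = pathParity g₁ g₂ (f₁ a) (f₂ a) l := by
  obtain ⟨δ, hδ, hfar⟩ := exists_dist_bound hg₁.continuousOn hg₂.continuousOn hdisj
  have hε : 0 < δ / 6 := by positivity
  obtain ⟨k₁, hk₁⟩ := hf₁.exists_modulus hε
  obtain ⟨k₂, hk₂⟩ := hf₂.exists_modulus hε
  obtain ⟨k₃, hk₃⟩ := hg₁.exists_modulus hε
  obtain ⟨k₄, hk₄⟩ := hg₂.exists_modulus hε
  have hle : ∀ {a b : ℕ}, a ≤ b → (1 : ℝ) / 2 ^ b ≤ 1 / 2 ^ a := fun h => by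
    gcongr; norm_num
  -- `pathParity_perturb` needs six times the perturbation as clearance.
  have e : 6 * (δ / 6) = δ := by ring
  refine ⟨k₁ + k₂ + k₃ + k₄, fun l hl a ha hta => pathParity_perturb hε
    (fun s hs u hu h => hk₃ s hs u hu (h.trans (hle (by omega))))
    (fun s hs u hu h => hk₄ s hs u hu (h.trans (hle (by omega)))) (by rwa [e])
    (hk₁ t ht a ha (hta.trans (hle (by omega)))) (hk₂ t ht a ha (hta.trans (hle (by omega))))
    (by rw [h0]; exact pf₁ t ht) (by rw [h0]; exact pf₁ a ha) (by rw [hL]; exact pf₂ t ht)⟩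

/-- Two computable paths in the unit square that connect opposite corners intersect in a computable
point. -/
theorem exists_computable_intersection {f₁ f₂ g₁ g₂ : ℝ → ℝ}
    (hf₁ : IsComputableOnUnitInterval f₁) (hf₂ : IsComputableOnUnitInterval f₂)
    (hg₁ : IsComputableOnUnitInterval g₁) (hg₂ : IsComputableOnUnitInterval g₂)
    (pf₁ : ∀ t ∈ Icc (0 : ℝ) 1, 0 ≤ f₁ t) (pf₂ : ∀ t ∈ Icc (0 : ℝ) 1, 0 ≤ f₂ t)
    (pg₁ : ∀ t ∈ Ioc (0 : ℝ) 1, 0 < g₁ t)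
    (pg₂ : ∀ t ∈ Icc (0 : ℝ) 1, g₂ t ∈ Icc (0 : ℝ) 1)
    (f₁0 : f₁ 0 = 0) (f₂0 : f₂ 0 = 0) (f₂1 : f₂ 1 = 1)
    (g₁0 : g₁ 0 = 0) (g₂0 : g₂ 0 = 1) (g₂1 : g₂ 1 = 0) :
    ∃ t ∈ Icc (0 : ℝ) 1, IsComputableReal (f₁ t) ∧ IsComputableReal (f₂ t) ∧
      ∃ s ∈ Icc (0 : ℝ) 1, f₁ t = g₁ s ∧ f₂ t = g₂ s := by
  by_cases hdisj : ∀ k j : ℕ, k ≤ 2 ^ j →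
      ¬ ∃ s ∈ Icc (0 : ℝ) 1, f₁ (k / 2 ^ j) = g₁ s ∧ f₂ (k / 2 ^ j) = g₂ s
  swap
  · push Not at hdisj
    obtain ⟨k, j, hk, hs⟩ := hdisj
    exact ⟨_, dyadic_mem_Icc hk, hf₁.isComputableReal_dyadic hk, hf₂.isComputableReal_dyadic hk, hs⟩
  have pg₁' : ∀ t ∈ Icc (0 : ℝ) 1, 0 ≤ g₁ t := fun t ht => by
    rcases ht.1.eq_or_lt with rfl | h
    · exact g₁0.ge
    · exact (pg₁ t ⟨h, ht.2⟩).le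
  obtain ⟨side, hside, hside2, hpar⟩ := exists_computable_side hf₁ hf₂ hg₁ hg₂ pf₁ pf₂ pg₁'
    (fun t ht => (pg₂ t ht).1) g₁0 g₂1 hdisj
  let P : ℝ → ZMod 2 → Prop := fun c w => ∃ l₀, ∀ l ≥ l₀, pathParity g₁ g₂ (f₁ c) (f₂ c) l = w
  let K := bisection side
  have hstep : ∀ j, K (j + 1) = 2 * K j + side (2 * K j + 1, j + 1) := fun j => rfl
  have hd : ∀ j : ℕ, ∀ a : ℝ, 2 * a / 2 ^ (j + 1) = a / 2 ^ j := fun j a => by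
    rw [pow_succ]; field_simp
  -- Invariant: eventual parity 1 at the left end and 0 at the right end. The midpoint replaces the
  -- end whose parity it shares.
  have hinv : ∀ j, K j + 1 ≤ 2 ^ j ∧ P ((K j : ℝ) / 2 ^ j) 1 ∧ P (((K j + 1 : ℕ) : ℝ) / 2 ^ j) 0 := by
    intro j
    induction j with
    | zero =>
      refine ⟨by simp [K, bisection], ⟨0, fun l _ => ?_⟩, ⟨0, fun l _ => ?_⟩⟩
      · simp only [K, bisection, Nat.cast_zero, zero_div]
        exact pathParity_eq_one (by rw [f₁0, g₁0]) (by rwa [f₁0]) (by rw [f₂0, g₂0]; norm_num) l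
      · simp only [K, bisection, zero_add, Nat.cast_one, pow_zero, div_one]
        exact pathParity_eq_zero (by rw [f₂1]; exact fun t ht => (pg₂ t ht).2) l
    | succ j ih =>
      obtain ⟨hle, hP1, hP0⟩ := ih
      have hmid := hpar (2 * K j + 1) (j + 1) (by rw [pow_succ]; omega)
      have hlt := hside2 (2 * K j + 1, j + 1)
      rw [hstep]
      rcases (by omega : side (2 * K j + 1, j + 1) = 0 ∨ side (2 * K j + 1, j + 1) = 1) with h | h
      · rw [h] at hmid ⊢
        refine ⟨by rw [pow_succ]; omega, ?_, by simpa only [Nat.cast_zero, add_zero] using hmid⟩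
        rw [add_zero, Nat.cast_mul, Nat.cast_ofNat, hd]
        exact hP1
      · rw [h] at hmid ⊢
        refine ⟨by rw [pow_succ]; omega, by simpa only [Nat.cast_one] using hmid, ?_⟩
        rw [show 2 * K j + 1 + 1 = 2 * (K j + 1) by ring, Nat.cast_mul, Nat.cast_ofNat, hd]
        exact hP0
  obtain ⟨t, ht⟩ := exists_bisection_limit (K := K) fun j => by
    have := hside2 (2 * K j + 1, j + 1)
    have := hstep j
    omega
  have hsucc : ∀ j, ((K j + 1 : ℕ) : ℝ) / 2 ^ j = (K j : ℝ) / 2 ^ j + 1 / 2 ^ j := fun j => by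
    push_cast; ring
  have hKle : ∀ j, K j ≤ 2 ^ j := fun j => (Nat.le_succ _).trans (hinv j).1
  have ht01 : t ∈ Icc (0 : ℝ) 1 := by
    have := ht 0
    have hK0 : K 0 = 0 := rfl
    simpa [hK0] using this
  have happrox : ∀ j, |(K j : ℝ) / 2 ^ j - t| ≤ 1 / 2 ^ j := fun j => by
    have h1 := ht j
    rw [hsucc] at h1
    rw [abs_le]
    constructor <;> linarith [h1.1, h1.2, show (0 : ℝ) < 1 / 2 ^ j by positivity]
  have hKc : Computable K := computable_bisection hside
  refine ⟨t, ht01, hf₁.isComputableReal_of_dyadic_approx pf₁ hKc hKle ht01 happrox,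
    hf₂.isComputableReal_of_dyadic_approx pf₂ hKc hKle ht01 happrox, ?_⟩
  by_contra hno
  obtain ⟨k, hk⟩ := exists_pathParity_eq hf₁ hf₂ hg₁ hg₂ pf₁ pf₂ g₁0 g₂1 ht01 hno
  obtain ⟨hle, ⟨l₁, hl₁⟩, ⟨l₀, hl₀⟩⟩ := hinv k
  -- The polygon level must be beyond the stability level `k` and the thresholds of both end points.
  have e1 := hk (k + l₁ + l₀) (by omega) _ (dyadic_mem_Icc (hKle k))
    (by rw [abs_sub_comm]; exact happrox k)
  have e0 := hk (k + l₁ + l₀) (by omega) _ (dyadic_mem_Icc hle) (by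
    have h1 := ht k
    rw [hsucc] at h1 ⊢
    rw [abs_le]
    constructor <;> linarith [h1.1, h1.2, show (0 : ℝ) < 1 / 2 ^ k by positivity])
  rw [hl₁ _ (by omega)] at e1
  rw [hl₀ _ (by omega), e1] at e0
  exact one_ne_zero e0

theorem theorem5 (f g : ℝ → Plane)
    (hf : IsComputablePath f) (hg : IsComputablePath g)
    (hf0 : f 0 = !₂[0, 0]) (hf1 : f 1 = !₂[1, 1])
    (hg0 : g 0 = !₂[0, 1]) (hg1 : g 1 = !₂[1, 0])
    (hfsq : ∀ t ∈ Ioo (0 : ℝ) 1, f t ∈ openUnitSquare)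
    (hgsq : ∀ t ∈ Ioo (0 : ℝ) 1, g t ∈ openUnitSquare)
    (hQ : ¬ FirstAlternative f g) :
    ∃ x : Plane, IsComputablePoint x ∧ x ∈ curve f ∩ curve g := by
  have hcases : ∀ t ∈ Icc (0 : ℝ) 1, t = 0 ∨ t = 1 ∨ t ∈ Ioo (0 : ℝ) 1 := fun t ht => by
    rcases ht.1.eq_or_lt with h | h
    · exact Or.inl h.symm
    · rcases ht.2.eq_or_lt with h' | h'
      · exact Or.inr (Or.inl h')
      · exact Or.inr (Or.inr ⟨h, h'⟩)
  have pf : ∀ i, ∀ t ∈ Icc (0 : ℝ) 1, 0 ≤ f t i := fun i t ht => by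
    rcases hcases t ht with rfl | rfl | h
    · rw [hf0]; fin_cases i <;> simp
    · rw [hf1]; fin_cases i <;> simp
    · exact (hfsq t h i).1.le
  have pg0 : ∀ t ∈ Ioc (0 : ℝ) 1, 0 < g t 0 := fun t ht => by
    rcases ht.2.eq_or_lt with rfl | h
    · simp [hg1]
    · exact (hgsq t ⟨ht.1, h⟩ 0).1
  have pg1 : ∀ t ∈ Icc (0 : ℝ) 1, g t 1 ∈ Icc (0 : ℝ) 1 := fun t ht => by
    rcases hcases t ht with rfl | rfl | h
    · simp [hg0]
    · simp [hg1]
    · exact ⟨(hgsq t h 1).1.le, (hgsq t h 1).2.le⟩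
  obtain ⟨t, ht, hc0, hc1, s, hs, e0, e1⟩ := exists_computable_intersection (hf 0) (hf 1) (hg 0)
    (hg 1) (pf 0) (pf 1) pg0 pg1 (by simp [hf0]) (by simp [hf0]) (by simp [hf1]) (by simp [hg0])
    (by simp [hg0]) (by simp [hg1])
  refine ⟨f t, Fin.forall_fin_two.2 ⟨hc0, hc1⟩, ⟨t, ht, rfl⟩, s, hs, ?_⟩
  ext i
  fin_cases i
  · exact e0.symm
  · exact e1.symm
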